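/- Let $k\ge 8$, let $\mathcal G=([k],E)$ be a directed graph (self-loops allowed) and write $i\to j$ if $(i,j)\in E$. Suppose $\mathcal G$ is strongly observable: for every $i\in[k]$, either $i\to i$, or $j\to i$ for all $j\ne i$. Let $\alpha(\mathcal G)$ be its independence number, the largest size of a set of vertices no two distinct elements of which are joined by an edge in either direction. In the $n$-round bandit problem with feedback graph $\mathcal G$ an adversary secretly fixes losses $\ell_1,\dots,\ell_n\in[0,1]^k$; in round $t$ the learner draws $A_t\in[k]$ from a distribution depending on its past actions and observations, and observes $\Phi(A_t,\ell_t)=\{(j,\ell_{tj}):A_t\to j\}$. Its regret is $\mathfrak R_n=\max_{b\in[k]}\mathbb E\big[\sum_{t=1}^n(\ell_{tA_t}-\ell_{tb})\big]$. Let $\mathcal X$ be the probability simplex in $\mathbb R^k$ and, with $\alpha=1-1/\log k$ (natural logarithm), $$F(x)=-\frac1{\alpha(1-\alpha)}\sum_{i=1}^k x_i^\alpha .$$ For $x\in\mathcal X$ with positive coordinates let $I_x=\{i: i\not\to i,\ x_i>1/2\}$ and, for a loss vector $\ell$ and a played arm $a$, define the estimate $E(x,a,\Phi(a,\ell))\in\mathbb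 R^k$ by $$E_i=\frac{\ell_i\,\mathbf 1\{a\to i\}}{\sum_{b:\,b\to i}x_b}\quad(i\notin I_x),\qquad E_i=\frac{(\ell_i-1)\,\mathbf 1\{a\ne i\}}{1-x_i}+1\quad(i\in I_x).$$ Online stochastic mirror descent (OSMD) with learning rate $\eta>0$ starts with $X_1=\arg\min_{x\in\mathcal X}F(x)$, samples $A_t$ from the distribution $X_t$, and updates $$X_{t+1}=\arg\min_{y\in\mathcal X}\ \eta\,\langle y,E(X_t,A_t,\Phi(A_t,\ell_t))\rangle+D_F(y,X_t),$$ where $D_F(y,x)=F(y)-F(x)-\langle\nabla F(x),y-x\rangle$. Then the estimator is unbiased, i.e. $\sum_a x_a E(x,a,\Phi(a,\ell))=\ell$ for all $x\in\mathcal X$ with positive coordinates and all $\ell\in[0,1]^k$; and there is a universal constant $C$ such that for every such $k$ and $\mathcal G$ and every $n$ there is a learning rate $\eta>0$ (independent of the losses) for which, for all loss sequences $\ell_1,\dots,\ell_n\in[0,1]^k$, the regret of OSMD satisfies $$\mathfrak R_n\le C\sqrt{\alpha(\mathcal G)\,n\,(\log k)^3}.$$ -/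

import Mathlib

namespace OnlineLearning

/-- A policy for `k` actions and observation space `S`. Given the history of the past rounds
(the pairs of played action and observation, oldest first), `π h a` is the conditional probability
of playing the action `a` next. -/
abbrev Policy (k : ℕ) (S : Type) : Type := List (Fin k × S) → Fin k → ℝ

/-- The history `(A₁, Φ₁), …, (A_{t-1}, Φ_{t-1})` available to the learner before it acts in
round `t`, when the sequence of actions is `a`, the losses are `ℓ` and the signal function
is `Φ`. -/
def history {k n : ℕ} {S : Type} (Φ : Fin k → (Fin k → ℝ) → S) (ℓ : Fin n → Fin k → ℝ)
    (a : Fin n → Fin k) (t : Fin n) : List (Fin k × S) :=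
  List.ofFn fun s : Fin (t : ℕ) =>
    (a (s.castLE t.isLt.le), Φ (a (s.castLE t.isLt.le)) (ℓ (s.castLE t.isLt.le)))

/-- The probability that the policy `π` plays exactly the action sequence `a` against the
losses `ℓ`. -/
noncomputable def trajectoryProb {k n : ℕ} {S : Type} (Φ : Fin k → (Fin k → ℝ) → S)
    (π : Policy k S) (ℓ : Fin n → Fin k → ℝ) (a : Fin n → Fin k) : ℝ :=
  ∏ t, π (history Φ ℓ a t) (a t)

/-- The regret `max_b 𝔼[∑ₜ (ℓ_t(A_t) - ℓ_t(b))]` of the policy `π` over `n` rounds against the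
losses `ℓ`. The expectation is over the (finitely many) action sequences. -/
noncomputable def regret {k n : ℕ} {S : Type} (Φ : Fin k → (Fin k → ℝ) → S)
    (π : Policy k S) (ℓ : Fin n → Fin k → ℝ) : ℝ :=
  ⨆ b : Fin k, ∑ a : Fin n → Fin k, trajectoryProb Φ π ℓ a * ∑ t, (ℓ t (a t) - ℓ t b)

/-- A minimiser of `f` over `s`. -/
noncomputable def argminOn {V : Type} [Nonempty V] (s : Set V) (f : V → ℝ) : V :=
  Classical.epsilon fun x => x ∈ s ∧ IsMinOn f s x

/-- The Bregman divergence `D_F(x, y) = F(x) - F(y) - ∇_{x-y} F(y)`, where `∇_v F(y)` is the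
directional derivative of `F` at `y` in the direction `v`. -/
noncomputable def bregman {k : ℕ} (F : (Fin k → ℝ) → ℝ) (x y : Fin k → ℝ) : ℝ :=
  F x - F y - lineDeriv ℝ F y (x - y)

/-- The three components that determine an instance of online stochastic mirror descent when the
action set is `{e₁, …, e_k}` (the action `e_i` is written `i`): the sampling scheme `P`, where
`P x a` is the probability of the action `a` under `P_x`; the potential `F`; the loss
estimator `E`. -/
structure OSMD (k : ℕ) (S : Type) where
  P : (Fin k → ℝ) → Fin k → ℝ
  F : (Fin k → ℝ) → ℝ
  E : (Fin k → ℝ) → Fin k → S → Fin k → ℝ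

namespace OSMD

variable {k : ℕ} {S : Type}

/-- The starting point `X₁ = argmin_{x ∈ 𝒳} F(x)`, where `𝒳` is the probability simplex. -/
noncomputable def start (A : OSMD k S) : Fin k → ℝ :=
  argminOn (stdSimplex ℝ (Fin k)) A.F

/-- The mirror descent update
`X_{t+1} = argmin_{y ∈ 𝒳} η ⟨y, E(X_t, A_t, Φ_t)⟩ + D_F(y, X_t)`. -/
noncomputable def update (A : OSMD k S) (η : ℝ) (x : Fin k → ℝ) (o : Fin k × S) : Fin k → ℝ :=
  argminOn (stdSimplex ℝ (Fin k)) fun y => η * (∑ i, y i * A.E x o.1 o.2 i) + bregman A.F y x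

/-- The iterate of mirror descent after the history `h`. -/
noncomputable def iterate (A : OSMD k S) (η : ℝ) (h : List (Fin k × S)) : Fin k → ℝ :=
  h.foldl (A.update η) A.start

/-- The policy of mirror descent with learning rate `η`: in round `t` it samples
`A_t ∼ P_{X_t}`. -/
noncomputable def policy (A : OSMD k S) (η : ℝ) : Policy k S :=
  fun h => A.P (A.iterate η h)

end OSMD

/-- The observation space of bandits with graph feedback: sets of pairs (arm, loss of that arm). -/
abbrev GraphSignal (k : ℕ) : Type := Set (Fin k × ℝ)

/-- Playing the arm `a` reveals the losses of all its out-neighbours: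
`Φ(a, ℓ) = {(j, ℓ_j) : j ∈ 𝒩(a)}` with `𝒩(a) = {j : (a, j) is an edge}`. -/
def graphSignal {k : ℕ} (G : Digraph (Fin k)) (a : Fin k) (ℓ : Fin k → ℝ) : GraphSignal k :=
  {p | G.Adj a p.1 ∧ p.2 = ℓ p.1}

/-- Every arm is observed by itself, or by all other arms. -/
def StronglyObservable {k : ℕ} (G : Digraph (Fin k)) : Prop :=
  ∀ i, (∀ j, j ≠ i → G.Adj j i) ∨ G.Adj i i

/-- The independence number of a directed graph: the largest number of vertices no two distinct
ones of which are joined by an edge, in either direction (self-loops do not matter). -/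
noncomputable def independenceNumber {k : ℕ} (G : Digraph (Fin k)) : ℕ :=
  G.toSimpleGraphInclusive.indepNum

/-- The loss of the arm `i` as it can be read off a signal that contains it. -/
noncomputable def observedLoss {k : ℕ} (σ : GraphSignal k) (i : Fin k) : ℝ :=
  Classical.epsilon fun y => (i, y) ∈ σ

/-- The exponent `α = 1 - 1 / log k`. -/
noncomputable def tsallisExponent (k : ℕ) : ℝ := 1 - 1 / Real.log k

/-- The Tsallis potential `F(x) = -(1 / (α (1 - α))) ∑ᵢ xᵢ^α` with `α = 1 - 1 / log k`. Mirror
descent evaluates it only on the probability simplex, which lies in its domain `[0, ∞)^k`. -/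
noncomputable def tsallis {k : ℕ} (x : Fin k → ℝ) : ℝ :=
  -(1 / (tsallisExponent k * (1 - tsallisExponent k))) * ∑ i, x i ^ tsallisExponent k

open Classical in
/-- The loss estimator for graph feedback. Normally it is importance weighting with the probability
of observing the arm `i`; for an arm without self-loop and with mass above `1/2`, importance
weighting is applied to `ℓ_i - 1`. -/
noncomputable def graphEstimator {k : ℕ} (G : Digraph (Fin k)) (x : Fin k → ℝ) (a : Fin k)
    (σ : GraphSignal k) (i : Fin k) : ℝ :=
  if ¬ G.Adj i i ∧ 1 / 2 < x i then
    (if a ≠ i then observedLoss σ i - 1 else 0) / (1 - x i) + 1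
  else
    (if G.Adj a i then observedLoss σ i else 0) / ∑ b with G.Adj b i, x b

/-- Mirror descent for bandits with graph feedback. The sampling scheme is
`P_x(e_i) = ⟨e_i, x⟩ = x_i`. -/
noncomputable def graphOSMD {k : ℕ} (G : Digraph (Fin k)) : OSMD k (GraphSignal k) where
  P x a := x a
  F := tsallis
  E := graphEstimator G

end OnlineLearning

/-!
Write `α = 1 - β` with `β = 1 / log k ≤ 1 / 2` for the exponent of the potential. The first-order
condition of the mirror descent update (`OSMD.update_le`) bounds the regret of a round, measured
with the unbiased loss estimates, by the decrease of the divergence to the best arm plus a stability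
term.
The divergence starts at `O(log k)` because `k ^ β = e` (`OSMD.sum_powBregman_start_le`), and the
choice of `η` balances the two contributions. The minimisers are interior points since the potential
is infinitely steep at the boundary (`pos_of_isMinOn`), so the first-order conditions are available.

The stability term decouples into coordinates and is at most `4 η² ∑ᵢ (Eᵢ - c)² xᵢ ^ (1 + β)`
whenever `E - c ≥ -1` and `η ≤ 1` (`stability_le`). Any constant `c` may be subtracted because the
iterates have the same total mass. If an arm `i` is estimated through `ℓᵢ - 1`, then `c = Eᵢ` works:
the noise of size `1 / (1 - xᵢ)` moves to the other arms, of total mass `1 - xᵢ`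
(`exists_shift_graphEstimator`).

What remains is `∑ᵢ xᵢ ^ (1 + β) / Pᵢ`, where `Pᵢ` is the probability that the loss of `i` is
observed. For the other arms without self-loop `Pᵢ = 1 - xᵢ ≥ 1 / 2`. Among the arms with
self-loops, a weighted Turán inequality (`exists_isIndepSet_sq_sum_le`) yields one with `Pᵢ ≥ W / (2 α(G))`, where `W` is
their total mass. Deleting this arm and repeating gives the bound
`2 α(G) ∑ wᵢ Wᵢ ^ (β - 1) ≤ 2 α(G) ∫₀¹ t ^ (β - 1) dt = 2 α(G) log k`
(`sum_rpow_div_inDegree_le`). Altogether the regret is at most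
`4 log k / η + 32 η n α(G) log k`, which is of order `√(α(G) n) log k`.
-/

namespace OnlineLearning

/-! ### Power functions and the scalar Bregman divergence -/

lemma rpow_le_tangent {p x y : ℝ} (hp0 : 0 ≤ p) (hp1 : p ≤ 1) (hx : 0 < x) (hy : 0 ≤ y) :
    y ^ p ≤ x ^ p + p * x ^ (p - 1) * (y - x) := by
  have h := rpow_one_add_le_one_add_mul_self (s := y / x - 1) (p := p)
    (by have : 0 ≤ y / x := by positivity
        linarith) hp0 hp1
  have hxp : 0 < x ^ p := by positivity
  rw [show 1 + (y / x - 1) = y / x by ring, Real.div_rpow hy hx.le, div_le_iff₀ hxp] at h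
  rw [Real.rpow_sub_one hx.ne']
  calc y ^ p ≤ _ := h
    _ = _ := by field_simp

/-- The summand of the negative Tsallis entropy with exponent `α`. -/
noncomputable def powPotential (α t : ℝ) : ℝ := -(1 / (α * (1 - α))) * t ^ α

/-- The derivative of `powPotential α`, valid for `t > 0`. -/
noncomputable def powDeriv (α t : ℝ) : ℝ := -(1 / (1 - α)) * t ^ (α - 1)

/-- The Bregman divergence of the scalar potential `powPotential α`. -/
noncomputable def powBregman (α y x : ℝ) : ℝ :=
  powPotential α y - powPotential α x - powDeriv α x * (y - x)

lemma powBregman_nonneg {α x y : ℝ} (h0 : 0 < α) (h1 : α < 1) (hx : 0 < x) (hy : 0 ≤ y) :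
    0 ≤ powBregman α y x := by
  have h := rpow_le_tangent h0.le h1.le hx hy
  have h1' : 0 < 1 - α := by linarith
  have : powBregman α y x =
      1 / (α * (1 - α)) * (x ^ α + α * x ^ (α - 1) * (y - x) - y ^ α) := by
    unfold powBregman powPotential powDeriv
    field_simp
    ring
  rw [this]
  exact mul_nonneg (by positivity) (by linarith)

/-- The mirror step `u ↦ (1 + β u) ^ (-1 / β)` for a normalised loss `u ≥ -1` moves by at most
`4 |u|`. -/
lemma abs_one_sub_rpow_le {β u : ℝ} (h0 : 0 < β) (h1 : β ≤ 1 / 2) (hu : -1 ≤ u) :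
    |1 - (1 + β * u) ^ (-(1 / β))| ≤ 4 * |u| := by
  have hpos : 0 < 1 + β * u := by nlinarith
  have hβ : 1 ≤ 1 / (2 * β) := by rw [le_div_iff₀ (by positivity)]; linarith
  have hβ1 : 1 ≤ 1 / β := by rw [le_div_iff₀ (by positivity)]; linarith
  rw [Real.rpow_neg hpos.le]
  set r := (1 + β * u) ^ (1 / β) with hr
  have hrpos : 0 < r := by positivity
  have hbern : 1 + u ≤ r := by
    have := one_add_mul_self_le_rpow_one_add (s := β * u) (by nlinarith) hβ1
    have e : 1 / β * (β * u) = u := by field_simp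
    rwa [e] at this
  rcases le_total 0 u with h | h
  · have hexp : r ≤ Real.exp u := by
      have : 1 + β * u ≤ Real.exp (β * u) := by linarith [Real.add_one_le_exp (β * u)]
      calc r ≤ Real.exp (β * u) ^ (1 / β) := Real.rpow_le_rpow hpos.le this (by positivity)
        _ = Real.exp u := by rw [← Real.exp_mul]; congr 1; field_simp
    have h2 : 1 - u ≤ r⁻¹ := by
      calc 1 - u ≤ Real.exp (-u) := by linarith [Real.add_one_le_exp (-u)]
        _ = (Real.exp u)⁻¹ := Real.exp_neg u
        _ ≤ r⁻¹ := by gcongr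
    have h3 : r⁻¹ ≤ 1 := inv_le_one_of_one_le₀ (by linarith)
    rw [abs_of_nonneg (by linarith), abs_of_nonneg h]
    linarith
  · -- Bernoulli with exponent `1 / (2 β) ≥ 1` bounds `√r` below by `1 / 2`.
    have hquarter : 1 / 4 ≤ r := by
      have hb := one_add_mul_self_le_rpow_one_add (s := β * u) (by nlinarith) hβ
      have e : 1 / (2 * β) * (β * u) = u / 2 := by field_simp
      rw [e] at hb
      have hsq : r = ((1 + β * u) ^ (1 / (2 * β))) ^ 2 := by
        rw [hr, ← Real.rpow_natCast, ← Real.rpow_mul hpos.le]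
        congr 1
        push_cast
        field_simp
      rw [hsq]
      nlinarith
    have hr1 : r ≤ 1 := Real.rpow_le_one hpos.le (by nlinarith) (by positivity)
    have h3 : 1 ≤ r⁻¹ := (one_le_inv₀ hrpos).2 hr1
    have h4 : r⁻¹ ≤ 4 := by
      rw [inv_le_comm₀ hrpos (by norm_num)]; linarith
    have h5 : r⁻¹ - 1 = r⁻¹ * (1 - r) := by field_simp
    rw [abs_of_nonpos (by linarith), abs_of_nonpos h]
    nlinarith

/-- The stability of one coordinate of a mirror descent step: `y ↦ s (x - y) - D(y, x)` is
largest at the point `z` with `f'(z) = f'(x) - s`, where its value is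
`D(x, z) ≤ s (x - z)`. -/
lemma stability_le {α x y s : ℝ} (h0 : 1 / 2 ≤ α) (h1 : α < 1) (hx : 0 < x) (hx1 : x ≤ 1)
    (hy : 0 ≤ y) (hs : -1 ≤ s) :
    s * (x - y) - powBregman α y x ≤ 4 * s ^ 2 * x ^ (2 - α) := by
  set β := 1 - α with hβ
  have hβ0 : 0 < β := by linarith
  have hβ1 : β ≤ 1 / 2 := by linarith
  have hxβ : 0 < x ^ β := by positivity
  have hxβ1 : x ^ β ≤ 1 := Real.rpow_le_one hx.le hx1 hβ0.le
  set u := s * x ^ β with hu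
  have hu1 : -1 ≤ u := by nlinarith
  have hpos : 0 < 1 + β * u := by nlinarith
  set z := x * (1 + β * u) ^ (-(1 / β)) with hz
  have hz0 : 0 < z := by positivity
  have hzpow : z ^ (α - 1) = x ^ (α - 1) * (1 + β * u) := by
    rw [hz, Real.mul_rpow hx.le (by positivity), ← Real.rpow_mul hpos.le]
    rw [show α - 1 = -β by rw [hβ]; ring, show -(1 / β) * -β = 1 by field_simp, Real.rpow_one]
  have hinv : x ^ (α - 1) * x ^ β = 1 := by
    rw [← Real.rpow_add hx]; simp [hβ]
  have hderiv : powDeriv α x - powDeriv α z = s := by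
    unfold powDeriv
    rw [hzpow, ← hβ]
    calc _ = 1 / β * (β * s * (x ^ (α - 1) * x ^ β)) := by rw [hu]; ring
      _ = s := by rw [hinv]; field_simp
  have hA := powBregman_nonneg (by linarith) h1 hz0 hy
  have hB := powBregman_nonneg (by linarith) h1 hx hz0.le
  have hmain : s * (x - y) - powBregman α y x ≤ s * (x - z) := by
    have e : powDeriv α x = powDeriv α z + s := by linarith
    unfold powBregman at hA hB ⊢
    rw [e] at hB ⊢
    linarith
  have habs : |x - z| ≤ x * (4 * |u|) := by
    have : x - z = x * (1 - (1 + β * u) ^ (-(1 / β))) := by rw [hz]; ring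
    rw [this, abs_mul, abs_of_pos hx]
    exact mul_le_mul_of_nonneg_left (abs_one_sub_rpow_le hβ0 hβ1 hu1) hx.le
  have hpow : x ^ (2 - α) = x * x ^ β := by
    rw [show 2 - α = 1 + β by rw [hβ]; ring, Real.rpow_add hx, Real.rpow_one]
  calc _ ≤ s * (x - z) := hmain
    _ ≤ |s| * |x - z| := by rw [← abs_mul]; exact le_abs_self _
    _ ≤ |s| * (x * (4 * |u|)) := by gcongr
    _ = 4 * s ^ 2 * x ^ (2 - α) := by
      rw [hpow, hu, abs_mul, abs_of_pos hxβ, ← sq_abs s]; ring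

/-! ### Weighted in-degrees and the independence number -/

open Classical in
/-- The weighted Turán inequality. Greedily choosing the vertex with the lightest closed
neighbourhood, and deleting that neighbourhood, splits `S` into `#I` parts `N`, with
`w(N) ≤ w(N[j])` for all `j ∈ N`; Cauchy-Schwarz concludes. -/
lemma exists_isIndepSet_sq_sum_le {V : Type*} [DecidableEq V] (H : SimpleGraph V)
    (w : V → ℝ) (hw : ∀ i, 0 ≤ w i) (S : Finset V) :
    ∃ I ⊆ S, H.IsIndepSet (I : Set V) ∧
      (∑ i ∈ S, w i) ^ 2 ≤
        I.card * ∑ i ∈ S, w i * ∑ j ∈ S with j = i ∨ H.Adj i j, w j := by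
  induction S using Finset.strongInduction with
  | H S ih =>
    rcases S.eq_empty_or_nonempty with rfl | hS
    · exact ⟨∅, by simp, by simp, by simp⟩
    obtain ⟨v, hv, hmin⟩ := S.exists_min_image
      (fun i => ∑ j ∈ S with j = i ∨ H.Adj i j, w j) hS
    set N := S.filter fun j => j = v ∨ H.Adj v j with hN
    have hvN : v ∈ N := by simp [hN, hv]
    have hNS : N ⊆ S := Finset.filter_subset _ _
    obtain ⟨I, hIS, hI, hle⟩ := ih (S \ N) (Finset.sdiff_ssubset hNS ⟨v, hvN⟩)
    have hIv : ∀ j ∈ I, j ≠ v ∧ ¬ H.Adj v j := by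
      intro j hj
      have := Finset.mem_sdiff.1 (hIS hj)
      simp only [hN, Finset.mem_filter, not_and, not_or] at this
      exact this.2 this.1
    have hvI : v ∉ I := fun h => (hIv v h).1 rfl
    refine ⟨insert v I, ?_, ?_, ?_⟩
    · intro j hj
      rcases Finset.mem_insert.1 hj with rfl | hj
      · exact hv
      · exact (Finset.mem_sdiff.1 (hIS hj)).1
    · rw [Finset.coe_insert, SimpleGraph.IsIndepSet, Set.pairwise_insert]
      refine ⟨hI, fun j hj _ => ⟨(hIv j hj).2, fun h => (hIv j hj).2 h.symm⟩⟩
    · rw [Finset.card_insert_of_notMem hvI]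
      have hsplit : ∀ f : V → ℝ, ∑ i ∈ S, f i = ∑ i ∈ S \ N, f i + ∑ i ∈ N, f i :=
        fun f => (Finset.sum_sdiff hNS).symm
      set m : ℝ := (I.card : ℝ) with hm
      have hm0 : 0 ≤ m := by positivity
      set a := ∑ i ∈ S \ N, w i
      set c := ∑ i ∈ N, w i with hc
      set q := ∑ i ∈ S \ N, w i * ∑ j ∈ S \ N with j = i ∨ H.Adj i j, w j
      have h1 : q ≤ ∑ i ∈ S \ N, w i * ∑ j ∈ S with j = i ∨ H.Adj i j, w j := by
        refine Finset.sum_le_sum fun i _ => mul_le_mul_of_nonneg_left ?_ (hw i)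
        exact Finset.sum_le_sum_of_subset_of_nonneg
          (Finset.filter_subset_filter _ Finset.sdiff_subset) fun _ _ _ => hw _
      have h2 : c ^ 2 ≤ ∑ i ∈ N, w i * ∑ j ∈ S with j = i ∨ H.Adj i j, w j := by
        rw [sq, hc, Finset.sum_mul]
        exact Finset.sum_le_sum fun i hi => mul_le_mul_of_nonneg_left (hmin i (hNS hi)) (hw i)
      have hq : 0 ≤ q := Finset.sum_nonneg fun i _ =>
        mul_nonneg (hw i) (Finset.sum_nonneg fun j _ => hw j)
      rw [hsplit w, hsplit fun i => w i * ∑ j ∈ S with j = i ∨ H.Adj i j, w j]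
      push_cast
      refine le_trans ?_ (mul_le_mul_of_nonneg_left (add_le_add h1 h2) (by positivity))
      -- `a² ≤ m q` gives `2 a c ≤ q + m c²`, even if `m = 0`.
      have h3 : 2 * a * c ≤ q + m * c ^ 2 := by
        have : (2 * a * c) ^ 2 ≤ (q + m * c ^ 2) ^ 2 := by
          nlinarith [sq_nonneg (q - m * c ^ 2), mul_le_mul_of_nonneg_right hle (sq_nonneg c)]
        exact abs_le_of_sq_le_sq' this (by positivity) |>.2
      nlinarith

open Classical in
/-- In a set `S` of vertices with self-loops, some vertex is observed with at least a fraction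
`1 / (2 α)` of the total weight of `S`. -/
lemma exists_sum_le_inDegree {k : ℕ} (G : Digraph (Fin k)) (w : Fin k → ℝ) (hw : ∀ i, 0 < w i)
    (S : Finset (Fin k)) (hS : S.Nonempty) (hloop : ∀ i ∈ S, G.Adj i i) :
    ∃ i ∈ S, ∑ j ∈ S, w j ≤ 2 * independenceNumber G * ∑ j ∈ S with G.Adj j i, w j := by
  obtain ⟨I, -, hI, hle⟩ :=
    exists_isIndepSet_sq_sum_le G.toSimpleGraphInclusive w (fun i => (hw i).le) S
  have hcard : (I.card : ℝ) ≤ independenceNumber G := by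
    exact_mod_cast hI.card_le_indepNum
  set A : ℝ := (independenceNumber G : ℝ)
  have hA : 0 ≤ A := by positivity
  have hW : 0 < ∑ j ∈ S, w j := Finset.sum_pos (fun i _ => hw i) hS
  set P : Fin k → ℝ := fun i => ∑ j ∈ S with G.Adj j i, w j with hP
  -- Every undirected edge is counted in one direction at least; self-loops are counted once.
  have hsum : ∑ i ∈ S, w i * ∑ j ∈ S with j = i ∨ G.toSimpleGraphInclusive.Adj i j, w j ≤
      2 * ∑ i ∈ S, w i * P i := by
    have hswap : ∑ i ∈ S, w i * P i = ∑ i ∈ S, w i * ∑ j ∈ S with G.Adj i j, w j := by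
      simp only [hP, Finset.mul_sum, Finset.sum_filter, mul_ite, mul_zero]
      rw [Finset.sum_comm]
      simp only [mul_comm]
    rw [two_mul]
    nth_rewrite 2 [hswap]
    rw [← Finset.sum_add_distrib]
    refine Finset.sum_le_sum fun i hi => ?_
    rw [← mul_add]
    refine mul_le_mul_of_nonneg_left ?_ (hw i).le
    simp only [hP, Finset.sum_filter]
    rw [← Finset.sum_add_distrib]
    refine Finset.sum_le_sum fun j hj => ?_
    have := (hw j).le
    split_ifs with h1 h2 h3 h3 <;> try linarith
    exfalso
    rcases h1 with rfl | h1
    · exact h2 (hloop _ hj)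
    · rw [Digraph.toSimpleGraphInclusive, SimpleGraph.fromRel_adj] at h1
      tauto
  by_contra! hcon
  have h1 : 2 * A * ∑ i ∈ S, w i * P i < (∑ j ∈ S, w j) ^ 2 := by
    rw [sq, Finset.mul_sum, Finset.sum_mul]
    refine Finset.sum_lt_sum_of_nonempty hS fun i hi => ?_
    have := mul_lt_mul_of_pos_left (hcon i hi) (hw i)
    simp only [hP]
    linarith
  have h2 : (I.card : ℝ) * ∑ i ∈ S, w i *
      ∑ j ∈ S with j = i ∨ G.toSimpleGraphInclusive.Adj i j, w j ≤
      A * (2 * ∑ i ∈ S, w i * P i) := by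
    refine mul_le_mul hcard hsum ?_ hA
    exact Finset.sum_nonneg fun i _ => mul_nonneg (hw i).le
      (Finset.sum_nonneg fun j _ => (hw j).le)
  linarith

open Classical in
/-- Deleting again and again the vertex with the largest observation weight, the weights in order
of deletion contribute a Riemann sum of `2 α ∫ t ^ (β - 1)`. -/
lemma sum_rpow_div_inDegree_le {k : ℕ} (G : Digraph (Fin k)) (w : Fin k → ℝ) (hw : ∀ i, 0 < w i)
    {β : ℝ} (h0 : 0 < β) (h1 : β ≤ 1)
    (S : Finset (Fin k)) (hloop : ∀ i ∈ S, G.Adj i i) :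
    ∑ i ∈ S, w i ^ (1 + β) / ∑ j ∈ S with G.Adj j i, w j ≤
      2 * independenceNumber G / β * (∑ i ∈ S, w i) ^ β := by
  induction S using Finset.strongInduction with
  | H S ih =>
    rcases S.eq_empty_or_nonempty with rfl | hS
    · simp [Real.zero_rpow h0.ne']
    obtain ⟨v, hv, hle⟩ := exists_sum_le_inDegree G w hw S hS hloop
    have ih' := ih (S.erase v) (Finset.erase_ssubset hv)
      fun i hi => hloop i (Finset.mem_of_mem_erase hi)
    set A : ℝ := (independenceNumber G : ℝ)
    have hA : 0 ≤ A := by positivity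
    set W := ∑ i ∈ S, w i with hW
    have hWpos : 0 < W := Finset.sum_pos (fun i _ => hw i) hS
    have hWv : ∑ i ∈ S.erase v, w i = W - w v := by
      rw [hW, ← Finset.add_sum_erase S w hv]; ring
    have hvW : w v ≤ W := Finset.single_le_sum (fun i _ => (hw i).le) hv
    have hPpos : ∀ i ∈ S, ∀ T ⊆ S, i ∈ T → 0 < ∑ j ∈ T with G.Adj j i, w j := fun i hi T _ hiT =>
      Finset.sum_pos (fun j _ => hw j) ⟨i, by simp [hiT, hloop i hi]⟩
    rw [← Finset.add_sum_erase S _ hv]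
    have hrest : ∑ i ∈ S.erase v, w i ^ (1 + β) / ∑ j ∈ S with G.Adj j i, w j ≤
        ∑ i ∈ S.erase v, w i ^ (1 + β) / ∑ j ∈ S.erase v with G.Adj j i, w j := by
      refine Finset.sum_le_sum fun i hi => ?_
      refine div_le_div_of_nonneg_left (Real.rpow_nonneg (hw i).le _)
        (hPpos i (Finset.mem_of_mem_erase hi) _ (Finset.erase_subset _ _) hi) ?_
      exact Finset.sum_le_sum_of_subset_of_nonneg
        (Finset.filter_subset_filter _ (Finset.erase_subset _ _)) fun _ _ _ => (hw _).le
    have hfirst : w v ^ (1 + β) / ∑ j ∈ S with G.Adj j v, w j ≤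
        2 * A * (w v * W ^ (β - 1)) := by
      have hP := hPpos v hv S subset_rfl hv
      set P := ∑ j ∈ S with G.Adj j v, w j
      rw [div_le_iff₀ hP, Real.rpow_add (hw v), Real.rpow_one, Real.rpow_sub_one hWpos.ne']
      have hb : w v ^ β ≤ W ^ β := Real.rpow_le_rpow (hw v).le hvW h0.le
      have e : 2 * A * (w v * (W ^ β / W)) * P = w v * W ^ β * ((2 * A * P) / W) := by ring
      have h2 : 1 ≤ (2 * A * P) / W := by rwa [one_le_div hWpos]
      have h3 : 0 ≤ w v * W ^ β := mul_nonneg (hw v).le (by positivity)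
      rw [e]
      calc w v * w v ^ β ≤ w v * W ^ β := mul_le_mul_of_nonneg_left hb (hw v).le
        _ ≤ _ := le_mul_of_one_le_right h3 h2
    have htan := rpow_le_tangent h0.le h1 hWpos (y := W - w v) (by linarith)
    rw [hWv] at ih'
    have hfac : 2 * A / β * (β * W ^ (β - 1) * w v) = 2 * A * (w v * W ^ (β - 1)) := by
      field_simp
    have := mul_le_mul_of_nonneg_left htan (show 0 ≤ 2 * A / β by positivity)
    linarith

/-! ### Minimisers of the regularised linear losses on the simplex -/

lemma argminOn_spec {V : Type} [Nonempty V] {s : Set V} {f : V → ℝ}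
    (h : ∃ x ∈ s, IsMinOn f s x) : argminOn s f ∈ s ∧ IsMinOn f s (argminOn s f) :=
  Classical.epsilon_spec (p := fun x => x ∈ s ∧ IsMinOn f s x) h

lemma tsallis_eq_sum {k : ℕ} (x : Fin k → ℝ) :
    tsallis x = ∑ i, powPotential (tsallisExponent k) (x i) := by
  simp only [tsallis, powPotential, Finset.mul_sum]

lemma hasDerivAt_powPotential {α t : ℝ} (h0 : 0 < α) (ht : 0 < t) :
    HasDerivAt (powPotential α) (powDeriv α t) t := by
  have h : HasDerivAt (powPotential α) (-(1 / (α * (1 - α))) * (α * t ^ (α - 1))) t :=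
    (Real.hasDerivAt_rpow_const (Or.inl ht.ne')).const_mul _
  refine h.congr_deriv ?_
  unfold powDeriv
  rw [one_div, one_div, mul_inv]
  field_simp

lemma hasLineDerivAt_sum_powPotential {k : ℕ} {α : ℝ} (h0 : 0 < α) {x : Fin k → ℝ}
    (hx : ∀ i, 0 < x i) (v : Fin k → ℝ) :
    HasLineDerivAt ℝ (fun y : Fin k → ℝ => ∑ i, powPotential α (y i))
      (∑ i, powDeriv α (x i) * v i) x v := by
  refine HasDerivAt.fun_sum fun i _ => ?_
  have h1 : HasDerivAt (fun t : ℝ => (x + t • v) i) (v i) 0 := by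
    have : HasDerivAt (fun t : ℝ => x i + t * v i) (1 * v i) 0 :=
      ((hasDerivAt_id (0 : ℝ)).mul_const (v i)).const_add (x i)
    simpa using this
  have h2 : HasDerivAt (powPotential α) (powDeriv α (x i)) ((x + (0 : ℝ) • v) i) := by
    simpa using hasDerivAt_powPotential h0 (hx i)
  exact HasDerivAt.comp (h₂ := powPotential α) (0 : ℝ) h2 h1

lemma bregman_tsallis {k : ℕ} (h0 : 0 < tsallisExponent k) {x : Fin k → ℝ}
    (hx : ∀ i, 0 < x i) (y : Fin k → ℝ) :
    bregman tsallis y x = ∑ i, powBregman (tsallisExponent k) (y i) (x i) := by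
  have hF : (tsallis : (Fin k → ℝ) → ℝ) =
      fun y => ∑ i, powPotential (tsallisExponent k) (y i) := funext tsallis_eq_sum
  rw [bregman, hF, (hasLineDerivAt_sum_powPotential h0 hx _).lineDeriv]
  simp only [powBregman, Finset.sum_sub_distrib, Pi.sub_apply]

/-- The slope of the Tsallis potential at the boundary is infinite, so minimisers of its linear
perturbations lie in the interior of the simplex. -/
lemma pos_of_isMinOn {k : ℕ} {α : ℝ} (h0 : 0 < α) (h1 : α < 1) {c x : Fin k → ℝ}
    (hx : x ∈ stdSimplex ℝ (Fin k))
    (hmin : IsMinOn (fun y : Fin k → ℝ => ∑ i, powPotential α (y i) + ∑ i, y i * c i)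
      (stdSimplex ℝ (Fin k)) x) (i : Fin k) : 0 < x i := by
  refine (hx.1 i).lt_of_ne' fun hi => ?_
  set K := 1 / (α * (1 - α)) with hK
  have hKpos : 0 < K := by
    have : 0 < 1 - α := by linarith
    positivity
  set M := K * ∑ j, x j ^ α + (c i - ∑ j, x j * c j) with hM
  have key : ∀ ε : ℝ, 0 < ε → ε < 1 → K ≤ M * ε ^ (1 - α) := by
    intro ε hε hε1
    set y : Fin k → ℝ := fun j => (1 - ε) * x j + ε * (if j = i then 1 else 0) with hy
    have hyS : y ∈ stdSimplex ℝ (Fin k) := by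
      refine ⟨fun j => ?_, ?_⟩
      · have := hx.1 j
        have : 0 ≤ 1 - ε := by linarith
        simp only [hy]
        positivity
      · simp only [hy, Finset.sum_add_distrib, ← Finset.mul_sum, hx.2]
        simp
    have hle := hmin hyS
    simp only [Set.mem_ofPred_eq] at hle
    have hpot : ∀ j, powPotential α (y j) ≤
        powPotential α (x j) + K * ε * x j ^ α - (if j = i then K * ε ^ α else 0) := by
      intro j
      unfold powPotential
      rw [← hK]
      by_cases hj : j = i
      · subst hj
        simp [hy, hi, Real.zero_rpow h0.ne']
      · have hb : 1 - ε ≤ (1 - ε) ^ α := by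
          have := Real.rpow_le_rpow_of_exponent_ge (x := 1 - ε) (by linarith) (by linarith) h1.le
          simpa using this
        have hyj : y j = (1 - ε) * x j := by simp [hy, hj]
        rw [hyj, Real.mul_rpow (by linarith) (hx.1 j), if_neg hj]
        have hxα : 0 ≤ K * x j ^ α := mul_nonneg hKpos.le (Real.rpow_nonneg (hx.1 j) _)
        nlinarith
    have hsum := Finset.sum_le_sum fun j (_ : j ∈ Finset.univ) => hpot j
    have hlin : ∑ j, y j * c j = ∑ j, x j * c j + ε * (c i - ∑ j, x j * c j) := by
      have : ∀ j, y j * c j =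
          x j * c j - ε * (x j * c j) + ε * (if j = i then c j else 0) := by
        intro j
        simp only [hy]
        split_ifs <;> ring
      simp only [this, Finset.sum_add_distrib, Finset.sum_sub_distrib, ← Finset.mul_sum]
      simp only [Finset.sum_ite_eq', Finset.mem_univ, if_true]
      ring
    simp only [Finset.sum_sub_distrib, Finset.sum_add_distrib, Finset.sum_ite_eq',
      Finset.mem_univ, if_true, ← Finset.mul_sum] at hsum
    have h3 : K * ε ^ α ≤ M * ε := by
      rw [hM]
      linarith
    have h4 : ε ^ α * ε ^ (1 - α) = ε := by
      rw [← Real.rpow_add hε]; simp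
    have h5 : 0 < ε ^ α := by positivity
    refine le_of_mul_le_mul_right ?_ h5
    calc K * ε ^ α ≤ M * ε := h3
      _ = M * ε ^ (1 - α) * ε ^ α := by nth_rewrite 1 [← h4]; ring
  have hlim : Filter.Tendsto (fun ε : ℝ => M * ε ^ (1 - α)) (nhdsWithin 0 (Set.Ioi 0))
      (nhds (M * 0)) := by
    refine Filter.Tendsto.const_mul _ ?_
    have := (Real.continuousAt_rpow_const (0 : ℝ) (1 - α) (Or.inr (by linarith))).tendsto
    rw [Real.zero_rpow (by linarith)] at this
    exact this.mono_left nhdsWithin_le_nhds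
  have := ge_of_tendsto hlim (b := K) (by
    filter_upwards [Ioo_mem_nhdsGT (zero_lt_one (α := ℝ))] with ε hε
    exact key ε hε.1 hε.2)
  linarith

/-- The first-order condition for linear perturbations of the Tsallis potential. -/
lemma sum_deriv_nonneg_of_isMinOn {k : ℕ} {α : ℝ} (h0 : 0 < α) {c x : Fin k → ℝ}
    (hx : x ∈ stdSimplex ℝ (Fin k)) (hpos : ∀ i, 0 < x i)
    (hmin : IsMinOn (fun y : Fin k → ℝ => ∑ i, powPotential α (y i) + ∑ i, y i * c i)
      (stdSimplex ℝ (Fin k)) x) {y : Fin k → ℝ} (hy : y ∈ stdSimplex ℝ (Fin k)) :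
    0 ≤ ∑ i, (powDeriv α (x i) + c i) * (y i - x i) := by
  have h1 : HasDerivAt (fun t : ℝ => ∑ i, powPotential α ((x + t • (y - x)) i) +
      t * ∑ i, (y i - x i) * c i)
      (∑ i, powDeriv α (x i) * (y - x) i + 1 * ∑ i, (y i - x i) * c i) 0 :=
    HasDerivAt.add (hasLineDerivAt_sum_powPotential h0 hpos (y - x))
      ((hasDerivAt_id (0 : ℝ)).mul_const _)
  have h2 := h1.tendsto_slope_zero_right
  have h3 := ge_of_tendsto h2 (b := 0) (by
    filter_upwards [Ioo_mem_nhdsGT (zero_lt_one (α := ℝ))] with t ht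
    have hmem : x + t • (y - x) ∈ stdSimplex ℝ (Fin k) :=
      (convex_stdSimplex ℝ (Fin k)).add_smul_sub_mem hx hy ⟨ht.1.le, ht.2.le⟩
    have hle := hmin hmem
    simp only [Set.mem_ofPred_eq] at hle
    have hlin : ∑ i, (x + t • (y - x)) i * c i =
        ∑ i, x i * c i + t * ∑ i, (y i - x i) * c i := by
      rw [Finset.mul_sum, ← Finset.sum_add_distrib]
      refine Finset.sum_congr rfl fun i _ => ?_
      simp only [Pi.add_apply, Pi.smul_apply, Pi.sub_apply, smul_eq_mul]
      ring
    rw [hlin] at hle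
    refine smul_nonneg (inv_nonneg.2 ht.1.le) ?_
    simp only [zero_add, zero_smul, add_zero, zero_mul]
    linarith)
  refine h3.trans_eq ?_
  rw [one_mul, ← Finset.sum_add_distrib]
  refine Finset.sum_congr rfl fun i _ => ?_
  simp only [Pi.sub_apply]
  ring

/-- Every linear perturbation of the Tsallis potential has a minimiser on the simplex, and the
chosen one is an interior point that satisfies the first-order condition. -/
lemma argminOn_stdSimplex_spec {k : ℕ} [NeZero k] {α : ℝ} (h0 : 0 < α) (h1 : α < 1)
    (c : Fin k → ℝ) (C : ℝ) {f : (Fin k → ℝ) → ℝ}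
    (hf : ∀ y, f y = ∑ i, powPotential α (y i) + ∑ i, y i * c i + C) :
    argminOn (stdSimplex ℝ (Fin k)) f ∈ stdSimplex ℝ (Fin k) ∧
    (∀ i, 0 < argminOn (stdSimplex ℝ (Fin k)) f i) ∧
    ∀ y ∈ stdSimplex ℝ (Fin k),
      0 ≤ ∑ i, (powDeriv α (argminOn (stdSimplex ℝ (Fin k)) f i) + c i) *
        (y i - argminOn (stdSimplex ℝ (Fin k)) f i) := by
  have hcont : Continuous f := by
    rw [funext hf]
    unfold powPotential
    have : ∀ i, Continuous fun y : Fin k → ℝ => y i ^ α := fun i =>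
      (continuous_apply i).rpow_const fun _ => Or.inr h0.le
    fun_prop
  have hne : (stdSimplex ℝ (Fin k)).Nonempty := ⟨_, single_mem_stdSimplex ℝ (0 : Fin k)⟩
  obtain ⟨hx, hmin⟩ := argminOn_spec
    ((isCompact_stdSimplex ℝ (Fin k)).exists_isMinOn hne hcont.continuousOn)
  set x := argminOn (stdSimplex ℝ (Fin k)) f
  have hmin' : IsMinOn (fun y : Fin k → ℝ => ∑ i, powPotential α (y i) + ∑ i, y i * c i)
      (stdSimplex ℝ (Fin k)) x := by
    intro y hy
    have := hmin hy
    simp only [Set.mem_ofPred_eq, hf] at this ⊢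
    linarith
  have hpos := pos_of_isMinOn h0 h1 hx hmin'
  exact ⟨hx, hpos, fun y hy => sum_deriv_nonneg_of_isMinOn h0 hx hpos hmin' hy⟩

/-! ### Mirror descent steps -/

lemma OSMD.update_spec {k : ℕ} [NeZero k] {S : Type} (A : OSMD k S) (hA : A.F = tsallis)
    (h0 : 0 < tsallisExponent k) (h1 : tsallisExponent k < 1) (η : ℝ) {x : Fin k → ℝ}
    (hx : ∀ i, 0 < x i) (o : Fin k × S) :
    A.update η x o ∈ stdSimplex ℝ (Fin k) ∧ (∀ i, 0 < A.update η x o i) ∧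
    ∀ y ∈ stdSimplex ℝ (Fin k),
      0 ≤ ∑ i, (powDeriv (tsallisExponent k) (A.update η x o i) +
        (η * A.E x o.1 o.2 i - powDeriv (tsallisExponent k) (x i))) *
        (y i - A.update η x o i) := by
  refine argminOn_stdSimplex_spec h0 h1
    (fun i => η * A.E x o.1 o.2 i - powDeriv (tsallisExponent k) (x i))
    (∑ i, (powDeriv (tsallisExponent k) (x i) * x i - powPotential (tsallisExponent k) (x i)))
    fun y => ?_
  rw [hA, bregman_tsallis h0 hx, Finset.mul_sum, ← Finset.sum_add_distrib,
    ← Finset.sum_add_distrib, ← Finset.sum_add_distrib]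
  refine Finset.sum_congr rfl fun i _ => ?_
  unfold powBregman
  ring

lemma OSMD.start_spec {k : ℕ} [NeZero k] {S : Type} (A : OSMD k S) (hA : A.F = tsallis)
    (h0 : 0 < tsallisExponent k) (h1 : tsallisExponent k < 1) :
    A.start ∈ stdSimplex ℝ (Fin k) ∧ (∀ i, 0 < A.start i) ∧
    ∀ y ∈ stdSimplex ℝ (Fin k),
      0 ≤ ∑ i, powDeriv (tsallisExponent k) (A.start i) * (y i - A.start i) := by
  have := argminOn_stdSimplex_spec h0 h1 (0 : Fin k → ℝ) 0 (f := A.F) fun y => by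
    rw [hA, tsallis_eq_sum]; simp
  simp only [Pi.zero_apply, add_zero] at this
  exact this

lemma OSMD.iterate_spec {k : ℕ} [NeZero k] {S : Type} (A : OSMD k S) (hA : A.F = tsallis)
    (h0 : 0 < tsallisExponent k) (h1 : tsallisExponent k < 1) (η : ℝ) (h : List (Fin k × S)) :
    A.iterate η h ∈ stdSimplex ℝ (Fin k) ∧ ∀ i, 0 < A.iterate η h i := by
  induction h using List.reverseRecOn with
  | nil => exact ⟨(A.start_spec hA h0 h1).1, (A.start_spec hA h0 h1).2.1⟩
  | append_singleton h o ih =>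
    have e : A.iterate η (h ++ [o]) = A.update η (A.iterate η h) o := by
      simp [OSMD.iterate, List.foldl_append]
    rw [e]
    exact ⟨(A.update_spec hA h0 h1 η ih.2 o).1, (A.update_spec hA h0 h1 η ih.2 o).2.1⟩

/-- One step of mirror descent. The estimate enters the stability term only up to a constant `c`,
because the iterates have the same total mass. -/
lemma OSMD.update_le {k : ℕ} [NeZero k] {S : Type} (A : OSMD k S) (hA : A.F = tsallis)
    (h0 : 1 / 2 ≤ tsallisExponent k) (h1 : tsallisExponent k < 1) {η : ℝ} (hη0 : 0 < η)
    (hη1 : η ≤ 1) {x : Fin k → ℝ} (hxS : x ∈ stdSimplex ℝ (Fin k)) (hx : ∀ i, 0 < x i)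
    (o : Fin k × S) {c : ℝ} (hc : ∀ i, -1 ≤ A.E x o.1 o.2 i - c) {y : Fin k → ℝ}
    (hy : y ∈ stdSimplex ℝ (Fin k)) :
    η * ∑ i, (x i - y i) * A.E x o.1 o.2 i +
        ∑ i, powBregman (tsallisExponent k) (y i) (A.update η x o i) ≤
      ∑ i, powBregman (tsallisExponent k) (y i) (x i) +
        4 * η ^ 2 * ∑ i, (A.E x o.1 o.2 i - c) ^ 2 * x i ^ (2 - tsallisExponent k) := by
  obtain ⟨hzS, hz, hopt⟩ := A.update_spec hA (by linarith) h1 η hx o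
  have hopt := hopt y hy
  set z := A.update η x o
  set e := A.E x o.1 o.2
  set α := tsallisExponent k
  have hstab : ∑ i, (η * (e i - c) * (x i - z i) - powBregman α (z i) (x i)) ≤
      4 * η ^ 2 * ∑ i, (e i - c) ^ 2 * x i ^ (2 - α) := by
    rw [Finset.mul_sum]
    refine Finset.sum_le_sum fun i _ => ?_
    have hx1 : x i ≤ 1 := by
      rw [← hxS.2]
      exact Finset.single_le_sum (fun j _ => (hx j).le) (Finset.mem_univ i)
    have := stability_le h0 h1 (hx i) hx1 (hz i).le (s := η * (e i - c)) (by nlinarith [hc i])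
    linarith
  have hzero : ∑ i, η * c * (x i - z i) = 0 := by
    rw [← Finset.mul_sum, Finset.sum_sub_distrib, hxS.2, hzS.2]; ring
  have hid : η * ∑ i, (x i - y i) * e i + ∑ i, powBregman α (y i) (z i) +
      ∑ i, (powDeriv α (z i) + (η * e i - powDeriv α (x i))) * (y i - z i) =
      ∑ i, powBregman α (y i) (x i) +
      ∑ i, (η * (e i - c) * (x i - z i) - powBregman α (z i) (x i)) +
      ∑ i, η * c * (x i - z i) := by
    rw [Finset.mul_sum]
    simp only [← Finset.sum_add_distrib]
    refine Finset.sum_congr rfl fun i _ => ?_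
    unfold powBregman
    ring
  linarith

/-- The divergence between the starting point and an arm. -/
lemma OSMD.sum_powBregman_start_le {k : ℕ} [NeZero k] {S : Type} (A : OSMD k S)
    (hA : A.F = tsallis) (h0 : 1 / 2 ≤ tsallisExponent k) (h1 : tsallisExponent k < 1)
    (hk : 2 ≤ k) (b : Fin k) :
    ∑ i, powBregman (tsallisExponent k) ((Pi.single b 1 : Fin k → ℝ) i) (A.start i) ≤
      4 * Real.log k := by
  obtain ⟨hxS, hx, hopt⟩ := A.start_spec hA (by linarith) h1
  have hopt := hopt _ (single_mem_stdSimplex ℝ b)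
  set x := A.start
  have hL : 0 < Real.log k := Real.log_pos (by exact_mod_cast hk)
  have hk0 : (0 : ℝ) < k := by positivity
  have hα : 1 - tsallisExponent k = 1 / Real.log k := by unfold tsallisExponent; ring
  set α := tsallisExponent k
  have hα0 : 0 < α := by linarith
  have hkpow : (k : ℝ) * ((1 : ℝ) / k) ^ α = Real.exp 1 := by
    rw [one_div, Real.inv_rpow hk0.le, ← Real.rpow_neg hk0.le]
    calc (k : ℝ) * (k : ℝ) ^ (-α) = (k : ℝ) ^ (1 : ℝ) * (k : ℝ) ^ (-α) := by rw [Real.rpow_one]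
      _ = (k : ℝ) ^ (1 / Real.log k) := by rw [← Real.rpow_add hk0, ← sub_eq_add_neg, hα]
      _ = Real.exp 1 := by
        rw [Real.rpow_def_of_pos hk0]; congr 1; field_simp
  -- The tangents of `t ↦ t ^ α` at `1 / k` show that the uniform distribution is the worst case.
  have hsum : ∑ i, x i ^ α ≤ Real.exp 1 := by
    have := Finset.sum_le_sum fun i (_ : i ∈ Finset.univ) =>
      rpow_le_tangent hα0.le h1.le (show (0 : ℝ) < 1 / k by positivity) (hx i).le
    refine this.trans ?_
    rw [Finset.sum_add_distrib, ← Finset.mul_sum, Finset.sum_sub_distrib, hxS.2]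
    simp only [Finset.sum_const, Finset.card_univ, Fintype.card_fin, nsmul_eq_mul]
    rw [hkpow, mul_one_div_cancel hk0.ne']
    simp
  have hF : ∑ i, powPotential α ((Pi.single b 1 : Fin k → ℝ) i) = -(1 / (α * (1 - α))) := by
    rw [Finset.sum_eq_single b]
    · simp [powPotential]
    · intro i _ hi
      simp [powPotential, hi, Real.zero_rpow hα0.ne']
    · simp
  have hX : ∑ i, powPotential α (x i) = -(1 / (α * (1 - α))) * ∑ i, x i ^ α := by
    simp only [powPotential, Finset.mul_sum]
  have hK : 1 / (α * (1 - α)) ≤ 2 * Real.log k := by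
    rw [hα, one_div, mul_inv, one_div, inv_inv]
    have : α⁻¹ ≤ 2 := by rw [inv_le_comm₀ hα0 (by norm_num)]; linarith
    exact mul_le_mul_of_nonneg_right this hL.le
  have hK0 : 0 ≤ 1 / (α * (1 - α)) := by
    have : 0 < 1 - α := by linarith
    positivity
  have he := Real.exp_one_lt_d9
  simp only [powBregman, Finset.sum_sub_distrib]
  rw [hF, hX]
  have : 1 / (α * (1 - α)) * (∑ i, x i ^ α - 1) ≤ 2 * Real.log k * 2 := by
    calc _ ≤ 1 / (α * (1 - α)) * 2 := mul_le_mul_of_nonneg_left (by linarith) hK0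
      _ ≤ _ := mul_le_mul_of_nonneg_right hK (by norm_num)
  linarith

/-! ### The loss estimator -/

lemma observedLoss_graphSignal {k : ℕ} (G : Digraph (Fin k)) {a i : Fin k} (h : G.Adj a i)
    (ℓ : Fin k → ℝ) : observedLoss (graphSignal G a ℓ) i = ℓ i := by
  have := Classical.epsilon_spec (p := fun y => (i, y) ∈ graphSignal G a ℓ) ⟨ℓ i, h, rfl⟩
  exact this.2

open Classical in
/-- On the signals that can occur, the estimator is given by the formulas with the true losses. -/
lemma graphEstimator_graphSignal {k : ℕ} {G : Digraph (Fin k)} (hG : StronglyObservable G)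
    (x : Fin k → ℝ) (a : Fin k) (ℓ : Fin k → ℝ) (i : Fin k) :
    graphEstimator G x a (graphSignal G a ℓ) i =
      if ¬ G.Adj i i ∧ 1 / 2 < x i then (if a ≠ i then ℓ i - 1 else 0) / (1 - x i) + 1
      else (if G.Adj a i then ℓ i else 0) / ∑ b with G.Adj b i, x b := by
  unfold graphEstimator
  split_ifs with h1 h2 h3 <;> try rfl
  · rw [observedLoss_graphSignal G ((hG i).resolve_right h1.1 a h2)]
  · rw [observedLoss_graphSignal G ‹_›]

open Classical in
lemma sum_inNeighbors_eq {k : ℕ} {G : Digraph (Fin k)} (hG : StronglyObservable G)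
    {x : Fin k → ℝ} (hxS : x ∈ stdSimplex ℝ (Fin k)) {i : Fin k} (hi : ¬ G.Adj i i) :
    ∑ b with G.Adj b i, x b = 1 - x i := by
  have : Finset.univ.filter (fun b => G.Adj b i) = Finset.univ.erase i := by
    ext b
    simp only [Finset.mem_filter, Finset.mem_univ, true_and, Finset.mem_erase, and_true]
    exact ⟨fun h hb => hi (hb ▸ h), fun h => (hG i).resolve_right hi b h⟩
  rw [this, ← hxS.2, ← Finset.add_sum_erase _ _ (Finset.mem_univ i)]
  ring

lemma sum_erase_eq {k : ℕ} {x : Fin k → ℝ} (hxS : x ∈ stdSimplex ℝ (Fin k)) (i : Fin k) :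
    ∑ j ∈ Finset.univ.erase i, x j = 1 - x i := by
  rw [← hxS.2, ← Finset.add_sum_erase _ _ (Finset.mem_univ i)]
  ring

lemma sum_mul_ite_ne {k : ℕ} {x : Fin k → ℝ} (hxS : x ∈ stdSimplex ℝ (Fin k)) (i : Fin k)
    (r : ℝ) : ∑ a, x a * (if a ≠ i then r else 0) = (1 - x i) * r := by
  rw [← sum_erase_eq hxS, Finset.sum_mul, ← Finset.add_sum_erase _ _ (Finset.mem_univ i)]
  simp only [ne_eq, not_true_eq_false, if_false, mul_zero, zero_add]
  exact Finset.sum_congr rfl fun a ha => by rw [if_pos (Finset.ne_of_mem_erase ha)]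

lemma lt_one_of_mem_stdSimplex {k : ℕ} (hk : 2 ≤ k) {x : Fin k → ℝ}
    (hxS : x ∈ stdSimplex ℝ (Fin k)) (hx : ∀ i, 0 < x i) (i : Fin k) : x i < 1 := by
  have : Nontrivial (Fin k) := Fin.nontrivial_iff_two_le.2 hk
  obtain ⟨j, hj⟩ := exists_ne i
  have : 0 < ∑ j ∈ Finset.univ.erase i, x j :=
    Finset.sum_pos (fun j _ => hx j) ⟨j, by simp [hj]⟩
  rw [sum_erase_eq hxS] at this
  linarith

open Classical in
lemma sum_inNeighbors_pos {k : ℕ} (hk : 2 ≤ k) {G : Digraph (Fin k)} (hG : StronglyObservable G)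
    {x : Fin k → ℝ} (hxS : x ∈ stdSimplex ℝ (Fin k)) (hx : ∀ i, 0 < x i) (i : Fin k) :
    0 < ∑ b with G.Adj b i, x b := by
  by_cases hi : G.Adj i i
  · exact Finset.sum_pos (fun b _ => hx b) ⟨i, by simp [hi]⟩
  · rw [sum_inNeighbors_eq hG hxS hi]
    linarith [lt_one_of_mem_stdSimplex hk hxS hx i]

lemma sum_mul_graphEstimator {k : ℕ} (hk : 2 ≤ k) {G : Digraph (Fin k)}
    (hG : StronglyObservable G) {x : Fin k → ℝ} (hxS : x ∈ stdSimplex ℝ (Fin k))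
    (hx : ∀ i, 0 < x i) (ℓ : Fin k → ℝ) (i : Fin k) :
    ∑ a, x a * graphEstimator G x a (graphSignal G a ℓ) i = ℓ i := by
  classical
  simp only [graphEstimator_graphSignal hG]
  split_ifs with h
  · have h1 : 1 - x i ≠ 0 := by linarith [lt_one_of_mem_stdSimplex hk hxS hx i]
    simp only [mul_add, mul_one, Finset.sum_add_distrib, hxS.2, ← mul_div_assoc,
      ← Finset.sum_div]
    rw [sum_mul_ite_ne hxS]
    field_simp
    ring
  · have hP := sum_inNeighbors_pos hk hG hxS hx i
    simp only [← mul_div_assoc, ← Finset.sum_div, mul_ite, mul_zero, ← Finset.sum_filter,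
      ← Finset.sum_mul]
    field_simp

lemma one_le_independenceNumber {k : ℕ} [NeZero k] (G : Digraph (Fin k)) :
    1 ≤ independenceNumber G := by
  have : G.toSimpleGraphInclusive.IsIndepSet (({0} : Finset (Fin k)) : Set (Fin k)) := by
    simp [SimpleGraph.IsIndepSet]
  have h := this.card_le_indepNum
  rwa [Finset.card_singleton] at h

lemma rpow_one_add_le_self {t β : ℝ} (h0 : 0 < t) (h1 : t ≤ 1) (hβ : 0 ≤ β) :
    t ^ (1 + β) ≤ t := by
  have := Real.rpow_le_rpow_of_exponent_ge h0 h1 (show 1 ≤ 1 + β by linarith)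
  simpa using this

open Classical in
/-- The weighted variances of the importance weighted estimates. -/
lemma sum_rpow_div_inNeighbors_le {k : ℕ} {G : Digraph (Fin k)}
    (hG : StronglyObservable G) {x : Fin k → ℝ} (hxS : x ∈ stdSimplex ℝ (Fin k))
    (hx : ∀ i, 0 < x i) {β : ℝ} (h0 : 0 < β) (h1 : β ≤ 1) :
    ∑ i with ¬ (¬ G.Adj i i ∧ 1 / 2 < x i), x i ^ (1 + β) / ∑ b with G.Adj b i, x b ≤
      2 * independenceNumber G / β + 2 := by
  have hx1 : ∀ i, x i ≤ 1 := fun i => by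
    rw [← hxS.2]
    exact Finset.single_le_sum (fun j _ => (hx j).le) (Finset.mem_univ i)
  rw [← Finset.sum_filter_add_sum_filter_not _ (fun i => G.Adj i i)]
  refine add_le_add ?_ ?_
  · set S : Finset (Fin k) := Finset.univ.filter fun i => G.Adj i i with hS
    have hsub : (Finset.univ.filter fun i => ¬ (¬ G.Adj i i ∧ 1 / 2 < x i)).filter
        (fun i => G.Adj i i) = S := by
      ext i
      simp only [hS, Finset.mem_filter, Finset.mem_univ, true_and]
      tauto
    rw [hsub]
    have hloop : ∀ i ∈ S, G.Adj i i := fun i hi => (Finset.mem_filter.1 hi).2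
    calc ∑ i ∈ S, x i ^ (1 + β) / ∑ b with G.Adj b i, x b
        ≤ ∑ i ∈ S, x i ^ (1 + β) / ∑ b ∈ S with G.Adj b i, x b := by
          refine Finset.sum_le_sum fun i hi => ?_
          refine div_le_div_of_nonneg_left (Real.rpow_nonneg (hx i).le _)
            (Finset.sum_pos (fun j _ => hx j) ⟨i, by simp [hi, hloop i hi]⟩) ?_
          exact Finset.sum_le_sum_of_subset_of_nonneg
            (Finset.filter_subset_filter _ (Finset.subset_univ _)) fun _ _ _ => (hx _).le
      _ ≤ 2 * independenceNumber G / β * (∑ i ∈ S, x i) ^ β :=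
          sum_rpow_div_inDegree_le G x hx h0 h1 S hloop
      _ ≤ 2 * independenceNumber G / β * 1 := by
          refine mul_le_mul_of_nonneg_left ?_ (by positivity)
          refine Real.rpow_le_one (Finset.sum_nonneg fun i _ => (hx i).le) ?_ h0.le
          rw [← hxS.2]
          exact Finset.sum_le_sum_of_subset_of_nonneg (Finset.subset_univ _)
            fun _ _ _ => (hx _).le
      _ = _ := mul_one _
  · calc _ ≤ ∑ i ∈ (Finset.univ.filter fun i => ¬ (¬ G.Adj i i ∧ 1 / 2 < x i)).filter
          (fun i => ¬ G.Adj i i), 2 * x i := by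
          refine Finset.sum_le_sum fun i hi => ?_
          simp only [Finset.mem_filter, Finset.mem_univ, true_and, not_and, not_lt] at hi
          have h2 := hi.1 hi.2
          rw [sum_inNeighbors_eq hG hxS hi.2, div_le_iff₀ (by linarith)]
          have := rpow_one_add_le_self (hx i) (hx1 i) h0.le
          nlinarith [hx i]
      _ ≤ ∑ i, 2 * x i := Finset.sum_le_sum_of_subset_of_nonneg (Finset.subset_univ _)
            fun i _ _ => by linarith [hx i]
      _ = 2 := by rw [← Finset.mul_sum, hxS.2, mul_one]

/-- Up to a constant vector the estimates are bounded below by `-1`, with weighted second moment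
of order `α(G) / β`. If the arm `i` is estimated through `ℓ i - 1`, its estimate is the constant
to subtract: this moves the noise of size `1 / (1 - x i)` to the other arms, whose total mass
`1 - x i` compensates for it. -/
lemma exists_shift_graphEstimator {k : ℕ} [NeZero k] (hk : 2 ≤ k) {G : Digraph (Fin k)}
    (hG : StronglyObservable G) {x : Fin k → ℝ} (hxS : x ∈ stdSimplex ℝ (Fin k))
    (hx : ∀ i, 0 < x i) {β : ℝ} (h0 : 0 < β) (h1 : β ≤ 1 / 2) {ℓ : Fin k → ℝ}
    (hℓ : ∀ i, ℓ i ∈ Set.Icc (0 : ℝ) 1) :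
    ∃ c : Fin k → ℝ,
      (∀ a i, -1 ≤ graphEstimator G x a (graphSignal G a ℓ) i - c a) ∧
      ∑ a, x a * ∑ i, (graphEstimator G x a (graphSignal G a ℓ) i - c a) ^ 2 * x i ^ (1 + β) ≤
        8 * (independenceNumber G / β) := by
  classical
  have hx1 : ∀ i, x i ≤ 1 := fun i => by
    rw [← hxS.2]
    exact Finset.single_le_sum (fun j _ => (hx j).le) (Finset.mem_univ i)
  have hP := sum_inNeighbors_pos hk hG hxS hx
  have hvar := sum_rpow_div_inNeighbors_le hG hxS hx h0 (by linarith)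
  have hA : 2 ≤ (independenceNumber G : ℝ) / β := by
    rw [le_div_iff₀ h0]
    have : (1 : ℝ) ≤ independenceNumber G := by exact_mod_cast one_le_independenceNumber G
    linarith
  set T : Finset (Fin k) := Finset.univ.filter fun i => ¬ (¬ G.Adj i i ∧ 1 / 2 < x i) with hT
  set P : Fin k → ℝ := fun i => ∑ b with G.Adj b i, x b
  set u : Fin k → Fin k → ℝ := fun a i => (if G.Adj a i then ℓ i else 0) / P i with hu
  have hu0 : ∀ a i, 0 ≤ u a i := fun a i => by
    refine div_nonneg ?_ (hP i).le
    split_ifs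
    exacts [(hℓ i).1, le_rfl]
  have hu2 : ∀ i, ∑ a, x a * u a i ^ 2 ≤ 1 / P i := fun i => by
    have : ∀ a, x a * u a i ^ 2 = (if G.Adj a i then x a else 0) * (ℓ i ^ 2 / P i ^ 2) := by
      intro a
      simp only [hu]
      split_ifs <;> ring
    simp only [this, ← Finset.sum_mul, ← Finset.sum_filter]
    change P i * (ℓ i ^ 2 / P i ^ 2) ≤ 1 / P i
    have e : P i * (ℓ i ^ 2 / P i ^ 2) = ℓ i ^ 2 / P i := by
      have := (hP i).ne'
      change P i ≠ 0 at this
      field_simp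
    rw [e]
    refine div_le_div_of_nonneg_right ?_ (hP i).le
    nlinarith [(hℓ i).1, (hℓ i).2]
  have huT : ∑ a, x a * ∑ i ∈ T, u a i ^ 2 * x i ^ (1 + β) ≤
      2 * independenceNumber G / β + 2 := by
    calc _ = ∑ i ∈ T, (∑ a, x a * u a i ^ 2) * x i ^ (1 + β) := by
          simp only [Finset.mul_sum, Finset.sum_mul]
          rw [Finset.sum_comm]
          simp only [mul_assoc]
      _ ≤ ∑ i ∈ T, x i ^ (1 + β) / P i := by
          refine Finset.sum_le_sum fun i _ => ?_
          have := mul_le_mul_of_nonneg_right (hu2 i) (Real.rpow_nonneg (hx i).le (1 + β))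
          rwa [one_div_mul_eq_div] at this
      _ ≤ _ := hvar
  have hET : ∀ a, ∀ i ∈ T, graphEstimator G x a (graphSignal G a ℓ) i = u a i := fun a i hi => by
    rw [graphEstimator_graphSignal hG, if_neg (Finset.mem_filter.1 hi).2]
  by_cases hspecial : ∃ i, ¬ G.Adj i i ∧ 1 / 2 < x i
  · obtain ⟨s, hs⟩ := hspecial
    have hs1 : 0 < 1 - x s := by linarith [lt_one_of_mem_stdSimplex hk hxS hx s]
    -- Two arms cannot both have mass above `1 / 2`.
    have hTs : T = Finset.univ.erase s := by
      ext i
      simp only [hT, Finset.mem_filter, Finset.mem_univ, true_and, Finset.mem_erase, and_true]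
      refine ⟨fun h hi => h (hi ▸ hs), fun hi h => ?_⟩
      have : x i ≤ ∑ j ∈ Finset.univ.erase s, x j :=
        Finset.single_le_sum (fun j _ => (hx j).le) (by simp [hi])
      rw [sum_erase_eq hxS] at this
      linarith [h.2, hs.2]
    set v : Fin k → ℝ := fun a => (if a ≠ s then 1 - ℓ s else 0) / (1 - x s) with hv
    have hv0 : ∀ a, 0 ≤ v a := fun a => by
      refine div_nonneg ?_ hs1.le
      split_ifs
      exacts [by linarith [(hℓ s).2], le_rfl]
    have hEs : ∀ a, graphEstimator G x a (graphSignal G a ℓ) s = 1 - v a := fun a => by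
      rw [graphEstimator_graphSignal hG, if_pos hs]
      simp only [hv]
      split_ifs <;> ring
    have hv2 : ∑ a, x a * v a ^ 2 ≤ 1 / (1 - x s) := by
      have : ∀ a, x a * v a ^ 2 =
          x a * (if a ≠ s then (1 - ℓ s) ^ 2 / (1 - x s) ^ 2 else 0) := by
        intro a
        simp only [hv, div_pow]
        split_ifs <;> ring
      simp only [this]
      rw [sum_mul_ite_ne hxS]
      have e : (1 - x s) * ((1 - ℓ s) ^ 2 / (1 - x s) ^ 2) = (1 - ℓ s) ^ 2 / (1 - x s) := by
        field_simp
      rw [e]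
      refine div_le_div_of_nonneg_right ?_ hs1.le
      nlinarith [(hℓ s).1, (hℓ s).2]
    have hmass : ∑ i ∈ T, x i ^ (1 + β) ≤ 1 - x s := by
      rw [← sum_erase_eq hxS s, hTs]
      exact Finset.sum_le_sum fun i _ => rpow_one_add_le_self (hx i) (hx1 i) h0.le
    have hmass0 : 0 ≤ ∑ i ∈ T, x i ^ (1 + β) :=
      Finset.sum_nonneg fun i _ => Real.rpow_nonneg (hx i).le _
    refine ⟨fun a => 1 - v a, fun a i => ?_, ?_⟩
    · by_cases hi : i = s
      · rw [hi, hEs]; linarith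
      · rw [hET a i (by simp [hTs, hi])]
        linarith [hu0 a i, hv0 a]
    · have hpoint : ∀ a, ∑ i, (graphEstimator G x a (graphSignal G a ℓ) i - (1 - v a)) ^ 2 *
          x i ^ (1 + β) ≤ 2 * ∑ i ∈ T, u a i ^ 2 * x i ^ (1 + β) +
            (2 * v a ^ 2 + 1) * ∑ i ∈ T, x i ^ (1 + β) := by
        intro a
        rw [← Finset.add_sum_erase _ _ (Finset.mem_univ s), hEs, ← hTs, Finset.mul_sum,
          Finset.mul_sum, ← Finset.sum_add_distrib]
        have : ∀ i ∈ T, (graphEstimator G x a (graphSignal G a ℓ) i - (1 - v a)) ^ 2 *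
            x i ^ (1 + β) ≤ 2 * (u a i ^ 2 * x i ^ (1 + β)) +
              (2 * v a ^ 2 + 1) * x i ^ (1 + β) := by
          intro i hi
          rw [hET a i hi]
          have h2 : (u a i - (1 - v a)) ^ 2 ≤ 2 * u a i ^ 2 + (2 * v a ^ 2 + 1) := by
            nlinarith [hu0 a i, hv0 a, sq_nonneg (u a i - v a)]
          have := mul_le_mul_of_nonneg_right h2 (Real.rpow_nonneg (hx i).le (1 + β))
          linarith
        have := Finset.sum_le_sum this
        simpa using this
      calc _ ≤ ∑ a, x a * (2 * ∑ i ∈ T, u a i ^ 2 * x i ^ (1 + β) +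
            (2 * v a ^ 2 + 1) * ∑ i ∈ T, x i ^ (1 + β)) :=
            Finset.sum_le_sum fun a _ => mul_le_mul_of_nonneg_left (hpoint a) (hx a).le
        _ = 2 * ∑ a, x a * ∑ i ∈ T, u a i ^ 2 * x i ^ (1 + β) +
            (2 * ∑ a, x a * v a ^ 2 + ∑ a, x a) * ∑ i ∈ T, x i ^ (1 + β) := by
            generalize ∑ i ∈ T, x i ^ (1 + β) = m
            have e : ∀ a, x a * (2 * ∑ i ∈ T, u a i ^ 2 * x i ^ (1 + β) +
                (2 * v a ^ 2 + 1) * m) = 2 * (x a * ∑ i ∈ T, u a i ^ 2 * x i ^ (1 + β)) +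
                (2 * (x a * v a ^ 2) + x a) * m := fun a => by ring
            simp only [e, Finset.sum_add_distrib, ← Finset.mul_sum, ← Finset.sum_mul]
        _ ≤ 2 * (2 * independenceNumber G / β + 2) + (2 * (1 / (1 - x s)) + 1) * (1 - x s) := by
            rw [hxS.2]
            have h3 : 0 ≤ 2 * (1 / (1 - x s)) + 1 := by positivity
            exact add_le_add (by linarith)
              (mul_le_mul (by linarith) hmass hmass0 h3)
        _ ≤ 8 * (independenceNumber G / β) := by
            have e : (2 * (1 / (1 - x s)) + 1) * (1 - x s) = 2 + (1 - x s) := by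
              field_simp
            have e2 : 2 * (independenceNumber G : ℝ) / β = 2 * (independenceNumber G / β) := by ring
            rw [e, e2]
            linarith [hx s]
  · have hTu : T = Finset.univ := by
      push Not at hspecial
      ext i
      simp only [hT, Finset.mem_filter, Finset.mem_univ, true_and, iff_true, not_and, not_lt]
      exact hspecial i
    rw [hTu] at hET huT
    refine ⟨0, fun a i => ?_, ?_⟩
    · rw [hET a i (Finset.mem_univ i), Pi.zero_apply]
      linarith [hu0 a i]
    · simp only [hET _ _ (Finset.mem_univ _), Pi.zero_apply, sub_zero]
      have e2 : 2 * (independenceNumber G : ℝ) / β = 2 * (independenceNumber G / β) := by ring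
      linarith

/-! ### Regret against trajectories -/

lemma history_snoc_castSucc {k n : ℕ} {S : Type} (Φ : Fin k → (Fin k → ℝ) → S)
    (ℓ : Fin (n + 1) → Fin k → ℝ) (a : Fin n → Fin k) (c : Fin k) (t : Fin n) :
    history Φ ℓ (Fin.snoc a c : Fin (n + 1) → Fin k) t.castSucc =
      history Φ (fun s => ℓ s.castSucc) a t := by
  unfold history
  congr 1
  funext s
  have : (Fin.snoc a c : Fin (n + 1) → Fin k) ((s.castLE t.isLt.le).castSucc) =
      a (s.castLE t.isLt.le) := Fin.snoc_castSucc ..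
  exact congrArg (fun b => (b, Φ b (ℓ (s.castLE t.isLt.le).castSucc))) this

lemma history_snoc_last {k n : ℕ} {S : Type} (Φ : Fin k → (Fin k → ℝ) → S)
    (ℓ : Fin (n + 1) → Fin k → ℝ) (a : Fin n → Fin k) (c : Fin k) :
    history Φ ℓ (Fin.snoc a c : Fin (n + 1) → Fin k) (Fin.last n) =
      List.ofFn fun t => (a t, Φ (a t) (ℓ t.castSucc)) := by
  unfold history
  change List.ofFn (n := n) _ = _
  congr 1
  funext s
  have : (Fin.snoc a c : Fin (n + 1) → Fin k) s.castSucc = a s := Fin.snoc_castSucc ..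
  exact congrArg (fun b => (b, Φ b (ℓ s.castSucc))) this

lemma trajectoryProb_snoc {k n : ℕ} {S : Type} (Φ : Fin k → (Fin k → ℝ) → S) (π : Policy k S)
    (ℓ : Fin (n + 1) → Fin k → ℝ) (a : Fin n → Fin k) (c : Fin k) :
    trajectoryProb Φ π ℓ (Fin.snoc a c : Fin (n + 1) → Fin k) =
      trajectoryProb Φ π (fun s => ℓ s.castSucc) a *
        π (List.ofFn fun t => (a t, Φ (a t) (ℓ t.castSucc))) c := by
  unfold trajectoryProb
  rw [Fin.prod_univ_castSucc, history_snoc_last]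
  simp only [history_snoc_castSucc, Fin.snoc_castSucc, Fin.snoc_last]

lemma sum_snoc {k n : ℕ} (f : (Fin (n + 1) → Fin k) → ℝ) :
    ∑ a, f a = ∑ a : Fin n → Fin k, ∑ c, f (Fin.snoc a c) := by
  rw [← (Fin.snocEquiv fun _ => Fin k).sum_comp, Fintype.sum_prod_type_right]
  rfl

lemma trajectoryProb_nonneg {k n : ℕ} {S : Type} {Φ : Fin k → (Fin k → ℝ) → S} {π : Policy k S}
    (hπ : ∀ h a, 0 ≤ π h a) (ℓ : Fin n → Fin k → ℝ) (a : Fin n → Fin k) :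
    0 ≤ trajectoryProb Φ π ℓ a :=
  Finset.prod_nonneg fun _ _ => hπ _ _

lemma sum_trajectoryProb {k n : ℕ} {S : Type} {Φ : Fin k → (Fin k → ℝ) → S} {π : Policy k S}
    (hπ : ∀ h, ∑ a, π h a = 1) (ℓ : Fin n → Fin k → ℝ) :
    ∑ a, trajectoryProb Φ π ℓ a = 1 := by
  induction n with
  | zero => simp [trajectoryProb]
  | succ n ih => simp only [sum_snoc, trajectoryProb_snoc, ← Finset.mul_sum, hπ, mul_one, ih]

/-- A potential `V` on histories that pays, up to `c` per round, for the conditional expected regret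
of the round controls the total regret. -/
lemma sum_trajectoryProb_mul_le {k n : ℕ} {S : Type} {Φ : Fin k → (Fin k → ℝ) → S}
    {π : Policy k S} (hπ0 : ∀ h a, 0 ≤ π h a) (hπ1 : ∀ h, ∑ a, π h a = 1)
    {V : List (Fin k × S) → ℝ} {c : ℝ} {b : Fin k} {K : Set (Fin k → ℝ)}
    (hstep : ∀ h, ∀ l ∈ K, ∑ a, π h a * (l a - l b + V (h ++ [(a, Φ a l)])) ≤ V h + c)
    (ℓ : Fin n → Fin k → ℝ) (hℓ : ∀ t, ℓ t ∈ K) :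
    ∑ a, trajectoryProb Φ π ℓ a *
      (∑ t, (ℓ t (a t) - ℓ t b) + V (List.ofFn fun t => (a t, Φ (a t) (ℓ t)))) ≤
        V [] + n * c := by
  induction n with
  | zero => simp [trajectoryProb]
  | succ n ih =>
    set ℓ' : Fin n → Fin k → ℝ := fun s => ℓ s.castSucc with hℓ'
    have ih' := ih ℓ' fun t => hℓ _
    rw [sum_snoc]
    have hround : ∀ a : Fin n → Fin k,
        ∑ d, trajectoryProb Φ π ℓ (Fin.snoc a d : Fin (n + 1) → Fin k) *
          (∑ t, (ℓ t ((Fin.snoc a d : Fin (n + 1) → Fin k) t) - ℓ t b) +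
            V (List.ofFn fun t => ((Fin.snoc a d : Fin (n + 1) → Fin k) t,
              Φ ((Fin.snoc a d : Fin (n + 1) → Fin k) t) (ℓ t)))) ≤
        trajectoryProb Φ π ℓ' a *
          (∑ t, (ℓ' t (a t) - ℓ' t b) + V (List.ofFn fun t => (a t, Φ (a t) (ℓ' t)))) +
          trajectoryProb Φ π ℓ' a * c := by
      intro a
      set h := List.ofFn fun t => (a t, Φ (a t) (ℓ' t)) with hh
      set R := ∑ t, (ℓ' t (a t) - ℓ' t b) with hR
      have e : ∀ d, trajectoryProb Φ π ℓ (Fin.snoc a d : Fin (n + 1) → Fin k) *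
          (∑ t, (ℓ t ((Fin.snoc a d : Fin (n + 1) → Fin k) t) - ℓ t b) +
            V (List.ofFn fun t => ((Fin.snoc a d : Fin (n + 1) → Fin k) t,
              Φ ((Fin.snoc a d : Fin (n + 1) → Fin k) t) (ℓ t)))) =
          trajectoryProb Φ π ℓ' a * (π h d * R + π h d *
            (ℓ (Fin.last n) d - ℓ (Fin.last n) b + V (h ++ [(d, Φ d (ℓ (Fin.last n)))]))) := by
        intro d
        rw [trajectoryProb_snoc, Fin.sum_univ_castSucc, List.ofFn_succ_last]
        simp only [Fin.snoc_castSucc, Fin.snoc_last]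
        simp only [hh, hR, hℓ']
        ring
      simp only [e, ← Finset.mul_sum, Finset.sum_add_distrib, ← Finset.sum_mul, hπ1, one_mul]
      rw [← mul_add]
      refine mul_le_mul_of_nonneg_left ?_ (trajectoryProb_nonneg hπ0 _ _)
      have := hstep h _ (hℓ (Fin.last n))
      linarith
    refine (Finset.sum_le_sum fun a _ => hround a).trans ?_
    rw [Finset.sum_add_distrib, ← Finset.sum_mul, sum_trajectoryProb hπ1]
    push_cast
    linarith

/-! ### Regret of mirror descent with graph feedback -/

lemma tsallisExponent_bounds {k : ℕ} (hk : 8 ≤ k) :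
    2 ≤ Real.log k ∧ 1 / 2 ≤ tsallisExponent k ∧ tsallisExponent k < 1 := by
  have h8 : Real.log 8 ≤ Real.log k := Real.log_le_log (by norm_num) (by exact_mod_cast hk)
  have h2 : Real.log 8 = 3 * Real.log 2 := by
    rw [show (8 : ℝ) = 2 ^ 3 by norm_num, Real.log_pow]; norm_num
  have h3 := Real.log_two_gt_d9
  have hL : 2 ≤ Real.log k := by linarith
  have hinv : 1 / Real.log k ≤ 1 / 2 := one_div_le_one_div_of_le (by norm_num) hL
  have hpos : 0 < 1 / Real.log k := by positivity
  exact ⟨hL, by unfold tsallisExponent; linarith, by unfold tsallisExponent; linarith⟩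

/-- The expected change of the divergence to an arm pays for the expected regret of a round. -/
lemma graphOSMD_step_le {k : ℕ} (hk : 8 ≤ k) {G : Digraph (Fin k)} (hG : StronglyObservable G)
    {η : ℝ} (hη0 : 0 < η) (hη1 : η ≤ 1) {x : Fin k → ℝ} (hxS : x ∈ stdSimplex ℝ (Fin k))
    (hx : ∀ i, 0 < x i) {ℓ : Fin k → ℝ} (hℓ : ∀ i, ℓ i ∈ Set.Icc (0 : ℝ) 1) (b : Fin k) :
    ∑ a, x a * (ℓ a - ℓ b + (∑ i, powBregman (tsallisExponent k) ((Pi.single b 1 : Fin k → ℝ) i)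
        ((graphOSMD G).update η x (a, graphSignal G a ℓ) i)) / η) ≤
      (∑ i, powBregman (tsallisExponent k) ((Pi.single b 1 : Fin k → ℝ) i) (x i)) / η +
        32 * η * (independenceNumber G * Real.log k) := by
  have : NeZero k := ⟨by omega⟩
  obtain ⟨hL, hα0, hα1⟩ := tsallisExponent_bounds hk
  have hβ : 1 / Real.log k ≤ 1 / 2 := one_div_le_one_div_of_le (by norm_num) hL
  obtain ⟨c, hc, hvar⟩ := exists_shift_graphEstimator (by omega) hG hxS hx
    (show 0 < 1 / Real.log k by positivity) hβ hℓ
  rw [show 1 + 1 / Real.log k = 2 - tsallisExponent k by unfold tsallisExponent; ring,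
    div_div_eq_mul_div, div_one] at hvar
  set y : Fin k → ℝ := Pi.single b 1 with hy
  set E : Fin k → Fin k → ℝ := fun a i => graphEstimator G x a (graphSignal G a ℓ) i with hE
  set D : Fin k → ℝ := fun a => ∑ i, powBregman (tsallisExponent k) (y i)
    ((graphOSMD G).update η x (a, graphSignal G a ℓ) i) with hD
  set D₀ := ∑ i, powBregman (tsallisExponent k) (y i) (x i) with hD₀
  set Q : Fin k → ℝ := fun a => ∑ i, (E a i - c a) ^ 2 * x i ^ (2 - tsallisExponent k) with hQ
  have hround : ∀ a, η * ∑ i, (x i - y i) * E a i + D a ≤ D₀ + 4 * η ^ 2 * Q a := fun a =>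
    (graphOSMD G).update_le rfl hα0 hα1 hη0 hη1 hxS hx (a, graphSignal G a ℓ) (hc a)
      (single_mem_stdSimplex ℝ b)
  have hsum : ∑ a, x a * (η * ∑ i, (x i - y i) * E a i + D a) ≤
      ∑ a, x a * (D₀ + 4 * η ^ 2 * Q a) :=
    Finset.sum_le_sum fun a _ => mul_le_mul_of_nonneg_left (hround a) (hx a).le
  have hlin : ∑ a, x a * ∑ i, (x i - y i) * E a i = ∑ a, x a * ℓ a - ℓ b := by
    calc _ = ∑ i, (x i - y i) * ∑ a, x a * E a i := by
          simp only [Finset.mul_sum]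
          rw [Finset.sum_comm]
          exact Finset.sum_congr rfl fun i _ => Finset.sum_congr rfl fun a _ => by ring
      _ = ∑ i, (x i - y i) * ℓ i := by
          simp only [hE, sum_mul_graphEstimator (show 2 ≤ k by omega) hG hxS hx]
      _ = _ := by
          simp only [sub_mul, Finset.sum_sub_distrib, hy]
          congr 1
          simp [Pi.single_apply]
  have hl : ∑ a, x a * (η * ∑ i, (x i - y i) * E a i + D a) =
      η * (∑ a, x a * ℓ a - ℓ b) + ∑ a, x a * D a := by
    rw [← hlin, Finset.mul_sum, ← Finset.sum_add_distrib]
    exact Finset.sum_congr rfl fun a _ => by ring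
  have hr : ∑ a, x a * (D₀ + 4 * η ^ 2 * Q a) = D₀ + 4 * η ^ 2 * ∑ a, x a * Q a := by
    rw [Finset.mul_sum]
    simp only [mul_add, Finset.sum_add_distrib, ← Finset.sum_mul, hxS.2, one_mul]
    congr 1
    exact Finset.sum_congr rfl fun a _ => by ring
  have hgoal : ∑ a, x a * (ℓ a - ℓ b + D a / η) =
      (η * (∑ a, x a * ℓ a - ℓ b) + ∑ a, x a * D a) / η := by
    simp only [mul_add, mul_sub, Finset.sum_add_distrib, Finset.sum_sub_distrib,
      ← Finset.sum_mul, hxS.2, one_mul, ← mul_div_assoc, ← Finset.sum_div]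
    field_simp
  have hfin : D₀ / η + 32 * η * (independenceNumber G * Real.log k) =
      (D₀ + 4 * η ^ 2 * (8 * (independenceNumber G * Real.log k))) / η := by
    field_simp
    ring
  rw [hgoal, hfin]
  refine div_le_div_of_nonneg_right ?_ hη0.le
  have := mul_le_mul_of_nonneg_left hvar (show 0 ≤ 4 * η ^ 2 by positivity)
  linarith

lemma graphOSMD_regret_le {k : ℕ} (hk : 8 ≤ k) {G : Digraph (Fin k)} (hG : StronglyObservable G)
    {η : ℝ} (hη0 : 0 < η) (hη1 : η ≤ 1) {n : ℕ} {ℓ : Fin n → Fin k → ℝ}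
    (hℓ : ∀ t i, ℓ t i ∈ Set.Icc (0 : ℝ) 1) :
    regret (graphSignal G) ((graphOSMD G).policy η) ℓ ≤
      4 * Real.log k / η + n * (32 * η * (independenceNumber G * Real.log k)) := by
  have : NeZero k := ⟨by omega⟩
  obtain ⟨hL, hα0, hα1⟩ := tsallisExponent_bounds hk
  have hit := (graphOSMD G).iterate_spec rfl (by linarith) hα1 η
  refine ciSup_le fun b => ?_
  set y : Fin k → ℝ := Pi.single b 1 with hy
  set V : List (Fin k × GraphSignal k) → ℝ := fun h =>
    (∑ i, powBregman (tsallisExponent k) (y i) ((graphOSMD G).iterate η h i)) / η with hV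
  have hV0 : ∀ h, 0 ≤ V h := fun h => div_nonneg
    (Finset.sum_nonneg fun i _ => powBregman_nonneg (by linarith) hα1 ((hit h).2 i)
      ((single_mem_stdSimplex ℝ b).1 i)) hη0.le
  have hπ0 : ∀ h a, 0 ≤ (graphOSMD G).policy η h a := fun h a => ((hit h).2 a).le
  have hmain := sum_trajectoryProb_mul_le (Φ := graphSignal G) (b := b)
    (K := {l | ∀ i, l i ∈ Set.Icc (0 : ℝ) 1}) hπ0 (fun h => (hit h).1.2)
    (V := V) (c := 32 * η * (independenceNumber G * Real.log k)) (fun h l hl => by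
      have e : ∀ o, (graphOSMD G).iterate η (h ++ [o]) =
          (graphOSMD G).update η ((graphOSMD G).iterate η h) o := fun o => by
        simp [OSMD.iterate, List.foldl_append]
      simp only [hV, e]
      exact graphOSMD_step_le hk hG hη0 hη1 (hit h).1 (hit h).2 hl b) ℓ hℓ
  have hstart : V [] ≤ 4 * Real.log k / η := div_le_div_of_nonneg_right
    ((graphOSMD G).sum_powBregman_start_le rfl hα0 hα1 (by omega) b) hη0.le
  refine le_trans (Finset.sum_le_sum fun a _ => mul_le_mul_of_nonneg_left ?_
    (trajectoryProb_nonneg hπ0 ℓ a)) (hmain.trans (by linarith))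
  linarith [hV0 (List.ofFn fun t => (a t, graphSignal G (a t) (ℓ t)))]

end OnlineLearning

theorem theorem6 :
    ∃ C : ℝ, 0 < C ∧ ∀ (k : ℕ), 8 ≤ k → ∀ G : Digraph (Fin k),
      OnlineLearning.StronglyObservable G →
      -- the loss estimator is unbiased
      (∀ x ∈ stdSimplex ℝ (Fin k), (∀ i, 0 < x i) →
        ∀ ℓ : Fin k → ℝ, (∀ i, ℓ i ∈ Set.Icc (0 : ℝ) 1) → ∀ i,
          ∑ a, (OnlineLearning.graphOSMD G).P x a *
            (OnlineLearning.graphOSMD G).E x a (OnlineLearning.graphSignal G a ℓ) i = ℓ i) ∧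
      -- the regret bound, for a learning rate that does not depend on the losses
      ∀ n : ℕ, ∃ η : ℝ, 0 < η ∧
        ∀ ℓ : Fin n → Fin k → ℝ, (∀ t i, ℓ t i ∈ Set.Icc (0 : ℝ) 1) →
          OnlineLearning.regret (OnlineLearning.graphSignal G)
              ((OnlineLearning.graphOSMD G).policy η) ℓ ≤
            C * Real.sqrt ((OnlineLearning.independenceNumber G : ℝ) * n * Real.log k ^ 3) := by
  refine ⟨36, by norm_num, fun k hk G hG => ⟨fun x hxS hx ℓ _ i =>
    OnlineLearning.sum_mul_graphEstimator (by omega) hG hxS hx ℓ i, fun n => ?_⟩⟩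
  have : NeZero k := ⟨by omega⟩
  rcases Nat.eq_zero_or_pos n with rfl | hn
  · exact ⟨1, one_pos, fun ℓ _ => by simp [OnlineLearning.regret]⟩
  have hL := (OnlineLearning.tsallisExponent_bounds hk).1
  set L := Real.log k
  set A : ℝ := (OnlineLearning.independenceNumber G : ℝ) with hA
  have hA1 : 1 ≤ A := by rw [hA]; exact_mod_cast OnlineLearning.one_le_independenceNumber G
  have hn1 : (1 : ℝ) ≤ n := by exact_mod_cast hn
  have hAn : 1 ≤ A * n := by nlinarith
  set r := Real.sqrt (A * n) with hr
  have hr1 : 1 ≤ r := Real.one_le_sqrt.2 hAn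
  have hr2 : r * r = A * n := Real.mul_self_sqrt (by linarith)
  -- `η` balances the two terms of the regret bound up to constants.
  refine ⟨1 / r, by positivity, fun ℓ hℓ => ?_⟩
  have hreg := OnlineLearning.graphOSMD_regret_le hk hG (η := 1 / r) (by positivity)
    ((div_le_one (by linarith)).2 hr1) hℓ
  have hval : 4 * L / (1 / r) + n * (32 * (1 / r) * (A * L)) = 36 * (r * L) := by
    have : n * (32 * (1 / r) * (A * L)) = 32 * L * (A * n) / r := by ring
    rw [this, ← hr2]
    field_simp
    ring
  have hsqrt : r * L ≤ Real.sqrt (A * n * L ^ 3) := by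
    refine Real.le_sqrt_of_sq_le ?_
    rw [mul_pow, sq r, hr2]
    exact mul_le_mul_of_nonneg_left (pow_le_pow_right₀ (by linarith) (by norm_num)) (by linarith)
  calc _ ≤ 36 * (r * L) := hreg.trans_eq hval
    _ ≤ _ := mul_le_mul_of_nonneg_left hsqrt (by norm_num)
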